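/- For words $x,y\in\mathbb{Z}_2^n$ let the fixed-length Levenshtein (FLL) distance $d_l(x,y)$ be the smallest integer $t\ge 0$ such that some word of length $n-t$ can be obtained both from $x$ and from $y$ by deleting $t$ symbols (equivalently, such that $x$ can be transformed into $y$ by $t$ deletions followed by $t$ insertions), and let $L_1(x)=\{y\in\mathbb{Z}_2^n : d_l(x,y)\le 1\}$ be the FLL ball of radius one centred at $x$. **Theorem 3.3.** Let $n>3$ be an integer, and let $x_1,\dots,x_n$ be independent random variables with $\Pr(x_i=0)=\Pr(x_i=1)=\tfrac12$ for each $i\in\{1,\dots,n\}$; put $x=x_1\cdots x_n$. Write $\mathbb{E}[|L_1|]=2^{-n}\sum_{y\in\mathbb{Z}_2^n}|L_1(y)|$ for the average size of the radius-one FLL balls in $\mathbb{Z}_2^n$. Then $$\mathbb{E}[|L_1|]=\frac{n^2}{2}-\frac{n}{2}-\frac{1}{2^{n-1}}+3,$$ and for every constant $c>0$, $$\Pr\left(|L_1(x)|-\mathbb{E}[|L_1|]\ge c\,n\sqrt{n-1}\right)\le e^{-2c^2} \quad\text{and}\quad \Pr\left(|L_1(x)|-\mathbb{E}[|L_1|]\le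 -c\,n\sqrt{n-1}\right)\le e^{-2c^2}.$$ -/

import Mathlib

open MeasureTheory ProbabilityTheory BigOperators

namespace FLL

/-- `m`-ary words of length `n`, i.e. the elements of `ℤ_m^n`. -/
abbrev Word (m n : ℕ) : Type := Fin n → ZMod m

/-- The deletion `t`-sphere centred at `x`: the words of length `n - t` obtained from `x` by
deleting `t` of its symbols, i.e. the subsequences of `x` that are `t` symbols shorter
than `x`. They are written as lists, so that lengths stay explicit; for `t = 0` the only one
is `x` itself. -/
def deletionSphere {m n : ℕ} (t : ℕ) (x : Word m n) : Set (List (ZMod m)) :=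
  {z | z.length + t = n ∧ z.Sublist (List.ofFn x)}

/-- The fixed-length Levenshtein distance: the smallest `t` for which the deletion
`t`-spheres of `x` and `y` meet. -/
noncomputable def dist {m n : ℕ} (x y : Word m n) : ℕ :=
  sInf {t : ℕ | (deletionSphere t x ∩ deletionSphere t y).Nonempty}

/-- Some `t` always qualifies in the definition of `dist` (delete all symbols), so its infimum
is a minimum. -/
theorem dist_set_nonempty {m n : ℕ} (x y : Word m n) :
    {t : ℕ | (deletionSphere t x ∩ deletionSphere t y).Nonempty}.Nonempty :=
  ⟨n, [], by simp [deletionSphere]⟩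

/-- The fixed-length Levenshtein ball of radius `t` centred at `x`. -/
def ball {m n : ℕ} (t : ℕ) (x : Word m n) : Set (Word m n) :=
  {y | dist x y ≤ t}

end FLL

/-!
The size of the ball of radius one is computed by comparing a word with its tail. If the word
`p c l` has `n` symbols, the members of its ball that start with `p` correspond to the ball of
`c l`, and the members that start with the other symbol are, up to that symbol, deletions of
`p c l` or words of which `c l`, once the other symbol is prepended, is a subsequence. Deletions
are counted by the runs of the word (`ncard_deletions`), insertions by the length alone
(`ncard_insertions`), and the overlap of the two sets when `p ≠ c` by the longest alternating
prefix (`ncard_between`). Unrolling the recursion, a word with `N + 1` symbols has a ball of size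
`N + 2` plus `N` for each change of symbol, minus the number of blocks of at least two
consecutive changes. The function `score` accumulates the last two terms from left to right.

Let the symbols be uniform and independent. The expected remaining score is affine in the number
`a` of unbroken changes just read (`meanScore`), which gives the mean size of a ball. Reading one
more symbol moves the conditional expectation to one of two equally likely values, which differ
by `N - a - (1 - 2⁻ᵏ) (a + 1)` if `k` symbols remain afterwards; since `a + k + 1 ≤ N`, this is
at most `N` in absolute value (`abs_score_step_le`). The first symbol has no influence, so there
are `N` such steps, and the Azuma–Hoeffding argument bounds the centred moment generating
function at `t` by `exp (N (t N)² / 8)`. Chernoff's bound then gives both tails, with some room,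
because `N < n`.
-/

namespace FLL

/-! ### Binary words as lists -/

/-- The number of runs (maximal constant blocks) of the nonempty list `p :: l`. -/
def runCount {α : Type*} [DecidableEq α] : α → List α → ℕ
  | _, [] => 1
  | p, c :: l => if c = p then runCount c l else runCount c l + 1

/-- The length of the longest alternating prefix of the nonempty list `p :: l`: the longest
prefix in which neighbouring entries differ. -/
def altLength {α : Type*} [DecidableEq α] : α → List α → ℕ
  | _, [] => 1
  | p, c :: l => if c = p then 1 else altLength c l + 1

theorem eq_or_eq_add_one (p c : ZMod 2) : c = p ∨ c = p + 1 := by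
  revert p c; decide

theorem add_one_ne (p : ZMod 2) : p + 1 ≠ p := by
  revert p; decide

theorem add_one_add_one (p : ZMod 2) : p + 1 + 1 = p := by
  revert p; decide

theorem ncard_eq_add_of_length {S : Set (List (ZMod 2))} {k : ℕ}
    (hS : ∀ y ∈ S, y.length = k + 1) (p : ZMod 2) :
    S.ncard = {y | p :: y ∈ S}.ncard + {y | (p + 1) :: y ∈ S}.ncard := by
  have hfin : S.Finite := (List.finite_length_eq (ZMod 2) (k + 1)).subset hS
  have hinj : ∀ c : ZMod 2, Function.Injective (List.cons c) := fun c => List.cons_injective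
  have hunion : S = List.cons p '' {y | p :: y ∈ S} ∪
      List.cons (p + 1) '' {y | (p + 1) :: y ∈ S} := by
    ext y
    constructor
    · intro hy
      cases y with
      | nil => simpa using hS _ hy
      | cons c y =>
        rcases eq_or_eq_add_one p c with rfl | rfl
        · exact Or.inl ⟨y, hy, rfl⟩
        · exact Or.inr ⟨y, hy, rfl⟩
    · rintro (⟨z, hz, rfl⟩ | ⟨z, hz, rfl⟩) <;> exact hz
  have hdisj : Disjoint (List.cons p '' {y | p :: y ∈ S})
      (List.cons (p + 1) '' {y | (p + 1) :: y ∈ S}) := by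
    rw [Set.disjoint_left]
    rintro _ ⟨y, -, rfl⟩ ⟨z, -, h⟩
    exact add_one_ne p (List.cons.inj h).1
  conv_lhs => rw [hunion]
  rw [Set.ncard_union_eq hdisj (hfin.preimage (hinj p).injOn |>.image _)
    (hfin.preimage (hinj (p + 1)).injOn |>.image _),
    Set.ncard_image_of_injective _ (hinj _), Set.ncard_image_of_injective _ (hinj _)]

theorem cons_sublist_cons_of_ne {α : Type*} {p q : α} {l m : List α} (h : p ≠ q) :
    (p :: l).Sublist (q :: m) ↔ (p :: l).Sublist m := by
  rw [List.sublist_cons_iff]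
  constructor
  · rintro (h' | ⟨r, hr, -⟩)
    · exact h'
    · exact absurd (List.cons.inj hr).1 h
  · exact Or.inl

theorem length_eq_and_sublist_iff {α : Type*} {y z : List α} :
    (y.length = z.length ∧ y.Sublist z) ↔ y = z :=
  ⟨fun h => h.2.eq_of_length h.1, fun h => h ▸ ⟨rfl, List.Sublist.refl _⟩⟩

theorem length_eq_and_sublist_iff' {α : Type*} {y z : List α} :
    (y.length = z.length ∧ z.Sublist y) ↔ y = z :=
  ⟨fun h => (h.2.eq_of_length h.1.symm).symm, fun h => h ▸ ⟨rfl, List.Sublist.refl _⟩⟩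

/-! ### Counting deletions and insertions -/

theorem ncard_deletions (p : ZMod 2) (l : List (ZMod 2)) :
    {y : List (ZMod 2) | y.length = l.length ∧ y.Sublist (p :: l)}.ncard = runCount p l := by
  induction l generalizing p with
  | nil =>
    rw [show {y : List (ZMod 2) | y.length = ([] : List (ZMod 2)).length ∧ y.Sublist [p]} = {[]} by
      ext y; simp +contextual]
    simp [runCount]
  | cons c l ih =>
    rw [ncard_eq_add_of_length (k := l.length) (fun y hy => hy.1) p]
    have h1 : {y | p :: y ∈ {y : List (ZMod 2) | y.length = (c :: l).length ∧
        y.Sublist (p :: c :: l)}} = {y | y.length = l.length ∧ y.Sublist (c :: l)} := by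
      ext y; simp
    have h2 : ∀ y, ((p + 1) :: y) ∈ {y : List (ZMod 2) | y.length = (c :: l).length ∧
        y.Sublist (p :: c :: l)} ↔ (p + 1) :: y = c :: l := by
      intro y
      rw [← length_eq_and_sublist_iff, Set.mem_ofPred_eq, cons_sublist_cons_of_ne (add_one_ne p)]
    rw [h1, ih c]
    simp only [h2, runCount]
    rcases eq_or_eq_add_one p c with rfl | rfl
    · simp
    · simp

theorem ncard_insertions (l : List (ZMod 2)) :
    {y : List (ZMod 2) | y.length = l.length + 1 ∧ l.Sublist y}.ncard = l.length + 2 := by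
  induction l with
  | nil =>
    rw [ncard_eq_add_of_length (k := 0) (fun y hy => hy.1) 0]
    simp
  | cons c l ih =>
    rw [ncard_eq_add_of_length (k := l.length + 1) (fun y hy => hy.1) c]
    have h1 : {y | c :: y ∈ {y : List (ZMod 2) | y.length = (c :: l).length + 1 ∧
        (c :: l).Sublist y}} = {y | y.length = l.length + 1 ∧ l.Sublist y} := by
      ext y; simp
    have h2 : {y | (c + 1) :: y ∈ {y : List (ZMod 2) | y.length = (c :: l).length + 1 ∧
        (c :: l).Sublist y}} = {c :: l} := by
      ext y
      rw [Set.mem_singleton_iff, ← length_eq_and_sublist_iff', Set.mem_ofPred_eq, Set.mem_ofPred_eq,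
        cons_sublist_cons_of_ne (add_one_ne c).symm]
      simp
    rw [h1, h2, ih]
    simp

/-- The words that lie strictly between `l` and `p (p + 1) l` in the subsequence order are as many
as the letters of the longest alternating prefix of `p (p + 1) l`. They form the overlap of the
insertion sphere of `l` and the deletion sphere of `p (p + 1) l`. -/
theorem ncard_between (p : ZMod 2) (l : List (ZMod 2)) :
    {y : List (ZMod 2) | y.length = l.length + 1 ∧ l.Sublist y ∧
      y.Sublist (p :: (p + 1) :: l)}.ncard = altLength p ((p + 1) :: l) := by
  induction l generalizing p with
  | nil =>
    rw [ncard_eq_add_of_length (k := 0) (fun y hy => hy.1) p]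
    have h1 : ∀ q : ZMod 2, {y | q :: y ∈ {y : List (ZMod 2) | y.length =
        ([] : List (ZMod 2)).length + 1 ∧ [].Sublist y ∧ y.Sublist [p, p + 1]}} = {[]} := by
      intro q
      ext y
      rcases eq_or_eq_add_one p q with rfl | rfl <;>
        simp +contextual [cons_sublist_cons_of_ne (add_one_ne _)]
    rw [h1, h1]
    simp [altLength]
  | cons c l ih =>
    rw [ncard_eq_add_of_length (k := l.length + 1) (fun y hy => hy.1) p]
    have h2 : {y | (p + 1) :: y ∈ {y : List (ZMod 2) | y.length = (c :: l).length + 1 ∧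
        (c :: l).Sublist y ∧ y.Sublist (p :: (p + 1) :: c :: l)}} = {c :: l} := by
      ext y
      rw [Set.mem_singleton_iff, ← length_eq_and_sublist_iff, Set.mem_ofPred_eq, Set.mem_ofPred_eq,
        cons_sublist_cons_of_ne (add_one_ne p), List.cons_sublist_cons]
      constructor
      · rintro ⟨h, -, h'⟩
        exact ⟨by simpa using h, h'⟩
      · rintro ⟨h, h'⟩
        rw [h'.eq_of_length h]
        simp
    rw [h2]
    rcases eq_or_eq_add_one p c with rfl | rfl
    · have h1 : {y | c :: y ∈ {y : List (ZMod 2) | y.length = (c :: l).length + 1 ∧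
          (c :: l).Sublist y ∧ y.Sublist (c :: (c + 1) :: c :: l)}} =
          {y | y.length = l.length + 1 ∧ l.Sublist y ∧
            y.Sublist ((c + 1) :: (c + 1 + 1) :: l)} := by
        ext y; simp [add_one_add_one]
      rw [h1, ih (c + 1)]
      simp [altLength, add_one_add_one, (add_one_ne c).symm]
    · have h1 : {y | p :: y ∈ {y : List (ZMod 2) | y.length = ((p + 1) :: l).length + 1 ∧
          ((p + 1) :: l).Sublist y ∧ y.Sublist (p :: (p + 1) :: (p + 1) :: l)}} =
          {(p + 1) :: l} := by
        ext y
        rw [Set.mem_singleton_iff, ← length_eq_and_sublist_iff', Set.mem_ofPred_eq,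
          Set.mem_ofPred_eq, cons_sublist_cons_of_ne (add_one_ne p), List.cons_sublist_cons]
        constructor
        · rintro ⟨h, h', -⟩
          exact ⟨by simpa using h, h'⟩
        · rintro ⟨h, h'⟩
          rw [← h'.eq_of_length h.symm]
          simp
      rw [h1]
      simp [altLength]

/-! ### The size of a ball of radius one -/

/-- The ball of radius one for lists: the words as long as `x` that share with `x` a subsequence
one symbol shorter. It is empty for `x = []`. -/
def listBall (x : List (ZMod 2)) : Set (List (ZMod 2)) :=
  {y | y.length = x.length ∧ ∃ z : List (ZMod 2), z.length + 1 = x.length ∧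
    z.Sublist x ∧ z.Sublist y}

theorem cons_mem_listBall_cons_self {p c : ZMod 2} {l y : List (ZMod 2)} :
    p :: y ∈ listBall (p :: c :: l) ↔ y ∈ listBall (c :: l) := by
  constructor
  · rintro ⟨hy, z, hz, h1, h2⟩
    exact ⟨by simpa using hy, z.tail, by simp at hz ⊢; omega, h1.tail, h2.tail⟩
  · rintro ⟨hy, z, hz, h1, h2⟩
    exact ⟨by simpa using hy, p :: z, by simp at hz ⊢; omega, h1.cons_cons p, h2.cons_cons p⟩

/-- For two words of equal length with different first symbols, a common subsequence one symbol
shorter must leave out one of the two first symbols, and then it is all the rest of that word. -/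
theorem cons_mem_listBall_cons_of_ne {p q : ZMod 2} (h : q ≠ p) {l y : List (ZMod 2)} :
    q :: y ∈ listBall (p :: l) ↔
      y.length = l.length ∧ (l.Sublist (q :: y) ∨ y.Sublist (p :: l)) := by
  constructor
  · rintro ⟨hy, z, hz, h1, h2⟩
    simp only [List.length_cons, Nat.add_right_cancel_iff] at hy hz
    refine ⟨hy, ?_⟩
    rcases List.sublist_cons_iff.1 h1 with h1' | ⟨z, rfl, -⟩
    · rw [← h1'.eq_of_length hz]
      exact Or.inl h2
    · rw [cons_sublist_cons_of_ne h.symm] at h2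
      rw [← h2.eq_of_length (hz.trans hy.symm)]
      exact Or.inr h1
  · rintro ⟨hy, h' | h'⟩
    · exact ⟨by simpa using hy, l, rfl, List.sublist_cons_self _ _, h'⟩
    · exact ⟨by simpa using hy, y, by simpa using hy, h', List.sublist_cons_self _ _⟩

theorem ncard_listBall_singleton (p : ZMod 2) : (listBall [p]).ncard = 2 := by
  rw [ncard_eq_add_of_length (k := 0) (fun y hy => hy.1) 0]
  simp [listBall]

/-- Members of the ball that start with `p` correspond to the ball of the tail; the others are
`p + 1` followed by a deletion of `p :: p :: l`, since the only other candidate, the insertion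
branch, again gives the deletion `p :: l`. -/
theorem ncard_listBall_cons_self (p : ZMod 2) (l : List (ZMod 2)) :
    (listBall (p :: p :: l)).ncard = (listBall (p :: l)).ncard + runCount p l := by
  rw [ncard_eq_add_of_length (k := l.length + 1) (fun y hy => hy.1) p]
  simp only [cons_mem_listBall_cons_self, cons_mem_listBall_cons_of_ne (add_one_ne p),
    Set.ofPred_mem_eq, cons_sublist_cons_of_ne (add_one_ne p).symm]
  have h := ncard_deletions p (p :: l)
  rw [runCount, if_pos rfl] at h
  rw [← h]
  congr 2
  ext y
  refine and_congr_right fun hy => or_iff_right_of_imp fun h' => ?_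
  rw [h'.eq_of_length hy.symm]
  exact List.sublist_cons_self _ _

/-- Members of the ball that start with `p` correspond to the ball of the tail; the tails of the
others are the deletions of `p (p + 1) l` together with the insertions into `l`. The correction
`altLength` is the overlap of these two sets, see `ncard_between`. -/
theorem ncard_listBall_cons_add_one (p : ZMod 2) (l : List (ZMod 2)) :
    (listBall (p :: (p + 1) :: l)).ncard + altLength p ((p + 1) :: l) =
      (listBall ((p + 1) :: l)).ncard + runCount p ((p + 1) :: l) + (l.length + 2) := by
  rw [ncard_eq_add_of_length (k := l.length + 1) (fun y hy => hy.1) p]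
  simp only [cons_mem_listBall_cons_self, cons_mem_listBall_cons_of_ne (add_one_ne p),
    Set.ofPred_mem_eq, List.cons_sublist_cons]
  rw [add_assoc, add_assoc, ← ncard_deletions, ← ncard_insertions l, ← ncard_between p l]
  congr 1
  have hfin : ∀ Q : List (ZMod 2) → Prop,
      {y : List (ZMod 2) | y.length = l.length + 1 ∧ Q y}.Finite := fun Q =>
    (List.finite_length_eq (ZMod 2) (l.length + 1)).subset fun y hy => hy.1
  have h := Set.ncard_union_add_ncard_inter _ _ (hfin fun y => y.Sublist (p :: (p + 1) :: l))
    (hfin fun y => l.Sublist y)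
  rw [List.length_cons, ← h]
  congr 2
  · ext y
    simp only [Set.mem_ofPred_eq, Set.mem_union]
    tauto
  · ext y
    simp only [Set.mem_ofPred_eq, Set.mem_inter_iff]
    tauto

theorem ball_one_eq {n : ℕ} (hn : 0 < n) (x : Word 2 n) :
    ball 1 x = {y | List.ofFn y ∈ listBall (List.ofFn x)} := by
  ext y
  simp only [ball, listBall, Set.mem_ofPred_eq, List.length_ofFn, true_and]
  constructor
  · intro h
    have hmem := Nat.sInf_mem (dist_set_nonempty x y)
    change (deletionSphere (dist x y) x ∩ deletionSphere (dist x y) y).Nonempty at hmem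
    obtain ⟨z, ⟨hz, hzx⟩, -, hzy⟩ := hmem
    -- At distance `0` the word `z` is `x` itself, so one more symbol is dropped.
    interval_cases hd : dist x y
    · refine ⟨z.tail, by simp; omega, (List.tail_sublist z).trans hzx,
        (List.tail_sublist z).trans hzy⟩
    · exact ⟨z, hz, hzx, hzy⟩
  · rintro ⟨z, hz, hzx, hzy⟩
    exact Nat.sInf_le ⟨z, ⟨hz, hzx⟩, hz, hzy⟩

theorem ncard_ball_one {n : ℕ} (hn : 0 < n) (x : Word 2 n) :
    (ball 1 x).ncard = (listBall (List.ofFn x)).ncard := by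
  rw [ball_one_eq hn, ← Set.ncard_image_of_injective _
    (List.ofFn_injective : Function.Injective (List.ofFn : Word 2 n → _))]
  congr 1
  ext l
  constructor
  · rintro ⟨y, hy, rfl⟩
    exact hy
  · intro hl
    have hlen : l.length = n := by simpa using hl.1
    subst hlen
    exact ⟨l.get, by simpa using hl, by simp⟩

/-- The part of the ball size that is collected while reading `l` after the symbol `p`, when `a`
changes of symbol in an unbroken row precede `p`. The next change of symbol contributes
`N - a`: a gain of `N` for the new run, and a loss of `1` for each of the `a` blocks of at least
two consecutive changes that it completes. A repeated symbol contributes nothing and resets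
`a`. -/
noncomputable def score {α : Type*} [DecidableEq α] (N : ℝ) : α → ℝ → List α → ℝ
  | _, _, [] => 0
  | p, a, c :: l => if c = p then score N c 0 l else N - a + score N c (a + 1) l

theorem score_eq_sub {α : Type*} [DecidableEq α] (N : ℝ) (p : α) (a : ℝ) (l : List α) :
    score N p a l = score N p 0 l - a * (altLength p l - 1) := by
  induction l generalizing p a with
  | nil => simp [score, altLength]
  | cons c l ih =>
    simp only [score, altLength]
    split_ifs
    · simp
    · rw [ih c (a + 1), ih c (0 + 1)]
      push_cast
      ring

theorem score_add_one {α : Type*} [DecidableEq α] (N : ℝ) (p : α) (a : ℝ) (l : List α) :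
    score (N + 1) p a l = score N p a l + (runCount p l - 1) := by
  induction l generalizing p a with
  | nil => simp [score, runCount]
  | cons c l ih =>
    simp only [score, runCount]
    split_ifs
    · rw [ih]
    · rw [ih]
      push_cast
      ring

/-- The size of the ball, with the parameter `N` of `score` equal to the number of pairs of
neighbouring symbols. -/
theorem ncard_listBall_cons (p : ZMod 2) (l : List (ZMod 2)) :
    ((listBall (p :: l)).ncard : ℝ) = l.length + 2 + score l.length p 0 l := by
  induction l generalizing p with
  | nil => simp [ncard_listBall_singleton, score]
  | cons c l ih =>
    rcases eq_or_eq_add_one p c with rfl | rfl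
    · rw [ncard_listBall_cons_self, Nat.cast_add, ih, List.length_cons]
      push_cast
      rw [score_add_one, score, if_pos rfl, runCount, if_pos rfl]
      ring
    · have h : ((listBall (p :: (p + 1) :: l)).ncard : ℝ) + altLength p ((p + 1) :: l) =
          (listBall ((p + 1) :: l)).ncard + runCount p ((p + 1) :: l) + (l.length + 2) :=
        mod_cast ncard_listBall_cons_add_one p l
      rw [ih] at h
      rw [List.length_cons, Nat.cast_add, Nat.cast_one, score_add_one, score,
        if_neg (add_one_ne p), score_eq_sub]
      simp only [altLength, runCount, if_neg (add_one_ne p)] at h ⊢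
      push_cast at h ⊢
      linarith

/-! ### The mean of the score -/

theorem sum_word_succ (k : ℕ) (g : List (ZMod 2) → ℝ) (p : ZMod 2) :
    ∑ x : Word 2 (k + 1), g (List.ofFn x) =
      ∑ x : Word 2 k, g (p :: List.ofFn x) + ∑ x : Word 2 k, g ((p + 1) :: List.ofFn x) := by
  rw [← (Fin.consEquiv fun _ : Fin (k + 1) => ZMod 2).sum_comp, Fintype.sum_prod_type]
  have h : ∀ f : ZMod 2 → ℝ, ∑ c, f c = f p + f (p + 1) := by
    intro f
    rcases eq_or_eq_add_one 0 p with rfl | rfl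
    · exact Fin.sum_univ_two f
    · rw [add_one_add_one, add_comm]
      exact Fin.sum_univ_two f
  rw [h]
  simp [Fin.consEquiv]

/-- The average of `score N p a` over the `2 ^ k` binary words of length `k`; it does not depend
on `p`, see `sum_score`. -/
noncomputable def meanScore (N : ℝ) (k : ℕ) (a : ℝ) : ℝ :=
  k * (N - 1) / 2 + (1 - (1 / 2) ^ k) * (1 - a)

theorem meanScore_succ (N : ℝ) (k : ℕ) (a : ℝ) :
    meanScore N (k + 1) a = (meanScore N k 0 + (N - a + meanScore N k (a + 1))) / 2 := by
  simp only [meanScore, pow_succ]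
  push_cast
  ring

theorem sum_score (N : ℝ) (k : ℕ) (p : ZMod 2) (a : ℝ) :
    ∑ x : Word 2 k, score N p a (List.ofFn x) = 2 ^ k * meanScore N k a := by
  induction k generalizing p a with
  | zero => simp [score, meanScore]
  | succ k ih =>
    rw [sum_word_succ k (score N p a) p]
    simp only [score, if_true, if_neg (add_one_ne p), Finset.sum_add_distrib, ih]
    rw [meanScore_succ]
    simp
    ring

/-! ### The moment generating function -/

/-- The martingale differences of the score: the conditional mean of the remaining score after a
change of symbol and after a repetition differ by at most `N`. The hypothesis says that the `a`
changes already seen, the current step and the `k` later ones are at most `N` steps in all. -/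
theorem abs_score_step_le {N : ℝ} {k : ℕ} {a : ℝ} (ha : 0 ≤ a) (hN : a + (k + 1) ≤ N) :
    |N - a + meanScore N k (a + 1) - meanScore N k 0| ≤ N := by
  have h0 : (0 : ℝ) ≤ (1 / 2) ^ k := by positivity
  have h1 : ((1 : ℝ) / 2) ^ k ≤ 1 := pow_le_one₀ (by norm_num) (by norm_num)
  have hk : (0 : ℝ) ≤ k := k.cast_nonneg
  have h : N - a + meanScore N k (a + 1) - meanScore N k 0 =
      N - a - (1 - (1 / 2) ^ k) * (a + 1) := by
    simp only [meanScore]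
    ring
  have h2 : (1 - ((1 : ℝ) / 2) ^ k) * (a + 1) ≤ 1 * (a + 1) := by gcongr; linarith
  have h3 : 0 ≤ (1 - ((1 : ℝ) / 2) ^ k) * (a + 1) := mul_nonneg (by linarith) (by linarith)
  rw [h, abs_le]
  constructor <;> linarith

/-- Hoeffding's lemma for a variable with two equally likely values at distance at most `r`. -/
theorem exp_add_exp_le {u v r : ℝ} (h : |v - u| ≤ r) :
    Real.exp u + Real.exp v ≤ 2 * Real.exp ((u + v) / 2 + r ^ 2 / 8) := by
  have h1 : Real.exp u + Real.exp v = 2 * (Real.exp ((u + v) / 2) * Real.cosh ((v - u) / 2)) := by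
    rw [Real.cosh_eq, mul_div_assoc', mul_add, ← Real.exp_add, ← Real.exp_add]
    ring_nf
  rw [h1, Real.exp_add]
  gcongr
  refine (Real.cosh_le_exp_half_sq _).trans (Real.exp_le_exp.2 ?_)
  have := sq_le_sq' (abs_le.1 h).1 (abs_le.1 h).2
  linarith

/-- The Azuma–Hoeffding bound on the moment generating function of the score, by conditioning on
the first symbol read. -/
theorem sum_exp_score_le {N : ℝ} (t : ℝ) (k : ℕ) (p : ZMod 2) {a : ℝ} (ha : 0 ≤ a)
    (hN : a + k ≤ N) :
    ∑ x : Word 2 k, Real.exp (t * score N p a (List.ofFn x)) ≤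
      2 ^ k * Real.exp (t * meanScore N k a + k * ((t * N) ^ 2 / 8)) := by
  induction k generalizing p a with
  | zero => simp [score, meanScore]
  | succ k ih =>
    push_cast at hN
    have hk : (0 : ℝ) ≤ k := k.cast_nonneg
    rw [sum_word_succ k (fun l => Real.exp (t * score N p a l)) p]
    simp only [score, if_true, if_neg (add_one_ne p), mul_add, Real.exp_add]
    rw [← Finset.mul_sum]
    have hstep : |(t * (N - a + meanScore N k (a + 1))) - t * meanScore N k 0| ≤ |t| * N := by
      rw [← mul_sub, abs_mul]
      exact mul_le_mul_of_nonneg_left (abs_score_step_le ha hN) (abs_nonneg t)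
    have hexp := exp_add_exp_le hstep
    rw [mul_pow, sq_abs, ← mul_pow] at hexp
    set K : ℝ := k * ((t * N) ^ 2 / 8) with hK
    calc _ ≤ 2 ^ k * Real.exp (t * meanScore N k 0 + K) +
          Real.exp (t * (N - a)) * (2 ^ k * Real.exp (t * meanScore N k (a + 1) + K)) := by
          gcongr
          · exact ih p le_rfl (by linarith)
          · exact ih (p + 1) (by linarith) (by linarith)
      _ = 2 ^ k * Real.exp K * (Real.exp (t * meanScore N k 0) +
          Real.exp (t * (N - a + meanScore N k (a + 1)))) := by
          rw [mul_add t (N - a), Real.exp_add, Real.exp_add, Real.exp_add]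
          ring
      _ ≤ 2 ^ k * Real.exp K * (2 * Real.exp ((t * meanScore N k 0 +
          t * (N - a + meanScore N k (a + 1))) / 2 + (t * N) ^ 2 / 8)) := by
          gcongr
      _ = 2 ^ (k + 1) * Real.exp (K + ((t * meanScore N k 0 +
          t * (N - a + meanScore N k (a + 1))) / 2 + (t * N) ^ 2 / 8)) := by
          rw [Real.exp_add K]
          ring
      _ = _ := by
          rw [meanScore_succ, ← Real.exp_add]
          congr 2
          rw [hK]
          push_cast
          ring

theorem sum_ncard_ball_one (N : ℕ) (F : ℝ → ℝ) :
    ∑ x : Word 2 (N + 1), F ((ball 1 x).ncard : ℝ) =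
      ∑ y : Word 2 N, F (N + 2 + score N (0 : ZMod 2) 0 (List.ofFn y)) +
        ∑ y : Word 2 N, F (N + 2 + score N (1 : ZMod 2) 0 (List.ofFn y)) := by
  simp_rw [ncard_ball_one N.succ_pos]
  rw [sum_word_succ N (fun l => F (listBall l).ncard) 0]
  simp [ncard_listBall_cons]

theorem expect_ncard_ball_one (N : ℕ) :
    (𝔼 x : Word 2 (N + 1), ((ball 1 x).ncard : ℝ)) = N + 2 + meanScore N N 0 := by
  rw [Finset.expect_eq_sum_div_card, sum_ncard_ball_one N fun s => s]
  simp only [Finset.sum_add_distrib, sum_score]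
  simp [ZMod.card]
  field_simp
  ring

theorem sum_exp_ncard_ball_one_le (N : ℕ) (t : ℝ) :
    ∑ x : Word 2 (N + 1), Real.exp (t * (((ball 1 x).ncard : ℝ) -
      𝔼 y : Word 2 (N + 1), ((ball 1 y).ncard : ℝ))) ≤
      2 ^ (N + 1) * Real.exp (N * ((t * N) ^ 2 / 8)) := by
  rw [expect_ncard_ball_one, sum_ncard_ball_one N
    (fun s => Real.exp (t * (s - (N + 2 + meanScore N N 0))))]
  have h : ∀ p : ZMod 2, ∑ y : Word 2 N, Real.exp (t * (N + 2 + score N p 0 (List.ofFn y) -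
      (N + 2 + meanScore N N 0))) ≤ 2 ^ N * Real.exp (N * ((t * N) ^ 2 / 8)) := by
    intro p
    have hp := sum_exp_score_le (N := N) t N p le_rfl (by simp)
    have hsplit : ∀ s : ℝ, Real.exp (t * (N + 2 + s - (N + 2 + meanScore N N 0))) =
        Real.exp (-(t * meanScore N N 0)) * Real.exp (t * s) := by
      intro s
      rw [← Real.exp_add]
      ring_nf
    simp only [hsplit]
    rw [← Finset.mul_sum]
    calc _ ≤ _ := mul_le_mul_of_nonneg_left hp (Real.exp_pos _).le
      _ = 2 ^ N * (Real.exp (-(t * meanScore N N 0)) *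
          Real.exp (t * meanScore N N 0 + N * ((t * N) ^ 2 / 8))) := by ring
      _ = _ := by rw [← Real.exp_add]; ring_nf
  calc _ ≤ _ := add_le_add (h 0) (h 1)
    _ = _ := by ring

/-! ### Random words -/

theorem measureReal_eq_word {n : ℕ} {Ω : Type*} [MeasurableSpace Ω] {P : Measure Ω}
    {X : Fin n → Ω → ZMod 2} (hindep : iIndepFun X P)
    (hunif : ∀ i, P.real {ω | X i ω = 0} = 1 / 2 ∧ P.real {ω | X i ω = 1} = 1 / 2)
    (x : Word 2 n) : P.real {ω | (fun i => X i ω) = x} = (1 / 2) ^ n := by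
  have hset : {ω | (fun i => X i ω) = x} = ⋂ i, X i ⁻¹' {x i} := by
    ext ω
    simp [funext_iff]
  have hmeas := hindep.meas_iInter (s := fun i => X i ⁻¹' {x i})
    (fun i => ⟨{x i}, trivial, rfl⟩)
  rw [hset, Measure.real, hmeas, ENNReal.toReal_prod]
  have hi : ∀ i, (P (X i ⁻¹' {x i})).toReal = 1 / 2 := by
    intro i
    rcases eq_or_eq_add_one 0 (x i) with h | h
    · rw [h]; exact (hunif i).1
    · rw [h]; exact (hunif i).2
  simp [hi]

/-- Markov's inequality for the exponential of a function of a uniform random word. -/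
theorem measureReal_word_le_sum {n : ℕ} {Ω : Type*} [MeasurableSpace Ω] {P : Measure Ω}
    [IsProbabilityMeasure P] {X : Fin n → Ω → ZMod 2} (hindep : iIndepFun X P)
    (hunif : ∀ i, P.real {ω | X i ω = 0} = 1 / 2 ∧ P.real {ω | X i ω = 1} = 1 / 2)
    (g : Word 2 n → ℝ) (u : ℝ) :
    P.real {ω | u ≤ g fun i => X i ω} ≤ (1 / 2) ^ n * ∑ x : Word 2 n, Real.exp (g x - u) := by
  classical
  have hset : {ω | u ≤ g fun i => X i ω} ⊆
      ⋃ x ∈ Finset.univ.filter fun x => u ≤ g x, {ω | (fun i => X i ω) = x} := by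
    intro ω hω
    simpa using hω
  calc _ ≤ _ := measureReal_mono hset (measure_ne_top _ _)
    _ ≤ ∑ x ∈ Finset.univ.filter fun x => u ≤ g x, P.real {ω | (fun i => X i ω) = x} :=
      measureReal_biUnion_finset_le _ _
    _ ≤ ∑ x ∈ Finset.univ.filter fun x => u ≤ g x, (1 / 2) ^ n * Real.exp (g x - u) := by
      refine Finset.sum_le_sum fun x hx => ?_
      rw [measureReal_eq_word hindep hunif]
      refine le_mul_of_one_le_right (by positivity) (Real.one_le_exp ?_)
      exact sub_nonneg.2 (Finset.mem_filter.1 hx).2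
    _ ≤ ∑ x : Word 2 n, (1 / 2) ^ n * Real.exp (g x - u) :=
      Finset.sum_le_sum_of_subset_of_nonneg (Finset.subset_univ _) fun _ _ _ => by positivity
    _ = _ := by rw [Finset.mul_sum]

theorem measureReal_ncard_ball_one_le {N : ℕ} {Ω : Type*} [MeasurableSpace Ω] {P : Measure Ω}
    [IsProbabilityMeasure P] {X : Fin (N + 1) → Ω → ZMod 2} (hindep : iIndepFun X P)
    (hunif : ∀ i, P.real {ω | X i ω = 0} = 1 / 2 ∧ P.real {ω | X i ω = 1} = 1 / 2)
    (t u : ℝ) :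
    P.real {ω | u ≤ t * (((ball 1 (fun i => X i ω)).ncard : ℝ) -
      𝔼 x : Word 2 (N + 1), ((ball 1 x).ncard : ℝ))} ≤
      Real.exp (N * ((t * N) ^ 2 / 8) - u) := by
  refine (measureReal_word_le_sum hindep hunif (fun x => t * (((ball 1 x).ncard : ℝ) -
    𝔼 x : Word 2 (N + 1), ((ball 1 x).ncard : ℝ))) u).trans ?_
  simp only [sub_eq_add_neg _ u, Real.exp_add]
  rw [← Finset.sum_mul, ← mul_assoc]
  refine mul_le_mul_of_nonneg_right ?_ (Real.exp_pos _).le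
  calc _ ≤ _ := mul_le_mul_of_nonneg_left (sum_exp_ncard_ball_one_le N t) (by positivity)
    _ = _ := by rw [← mul_assoc, ← mul_pow]; norm_num

end FLL

theorem theorem3p3 (n : ℕ) (hn : 3 < n)
    {Ω : Type*} [MeasurableSpace Ω] (P : Measure Ω) [IsProbabilityMeasure P]
    (X : Fin n → Ω → ZMod 2) (hX : ∀ i, Measurable (X i))
    (hindep : iIndepFun X P)
    (hunif : ∀ i, P.real {ω | X i ω = 0} = 1 / 2 ∧ P.real {ω | X i ω = 1} = 1 / 2) :
    (𝔼 x : FLL.Word 2 n, ((FLL.ball 1 x).ncard : ℝ)) =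
        (n : ℝ) ^ 2 / 2 - (n : ℝ) / 2 - 1 / 2 ^ (n - 1) + 3 ∧
    ∀ c : ℝ, 0 < c →
      P.real {ω | ((FLL.ball 1 (fun i => X i ω)).ncard : ℝ) -
          (𝔼 x : FLL.Word 2 n, ((FLL.ball 1 x).ncard : ℝ)) ≥
            c * n * Real.sqrt ((n : ℝ) - 1)} ≤ Real.exp (-2 * c ^ 2) ∧
      P.real {ω | ((FLL.ball 1 (fun i => X i ω)).ncard : ℝ) -
          (𝔼 x : FLL.Word 2 n, ((FLL.ball 1 x).ncard : ℝ)) ≤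
            -(c * n * Real.sqrt ((n : ℝ) - 1))} ≤ Real.exp (-2 * c ^ 2) := by
  obtain ⟨N, rfl⟩ : ∃ N, n = N + 1 := ⟨n - 1, by omega⟩
  constructor
  · rw [FLL.expect_ncard_ball_one, FLL.meanScore, Nat.add_sub_cancel, one_div_pow]
    push_cast
    ring
  intro c hc
  have hN : (0 : ℝ) < N := by
    have : 0 < N := by omega
    exact_mod_cast this
  push_cast
  rw [add_sub_cancel_right]
  set S := Real.sqrt (N : ℝ) with hS
  have hSpos : 0 < S := Real.sqrt_pos.2 hN
  have hsq : S ^ 2 = N := Real.sq_sqrt hN.le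
  -- The minimizer of the Chernoff exponent `t ^ 2 * N * (N + 1) ^ 2 / 8 - t * c * (N + 1) * S`.
  set t : ℝ := 4 * c / ((N + 1) * S) with ht
  have htpos : 0 < t := by positivity
  have hu : t * (c * (N + 1) * S) = 4 * c ^ 2 := by
    rw [ht]
    field_simp
  have hvar : N * ((t * N) ^ 2 / 8) ≤ 2 * c ^ 2 := by
    have h1 : N * ((t * N) ^ 2 / 8) = 2 * c ^ 2 * (N / (N + 1)) ^ 2 := by
      rw [ht, div_mul_eq_mul_div, div_pow, mul_pow ((N : ℝ) + 1), hsq]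
      field_simp
      ring
    rw [h1]
    refine mul_le_of_le_one_right (by positivity) (pow_le_one₀ (by positivity) ?_)
    rw [div_le_one (by positivity)]
    linarith
  constructor
  · refine (measureReal_mono fun ω hω => ?_).trans
      ((FLL.measureReal_ncard_ball_one_le hindep hunif t (4 * c ^ 2)).trans
        (Real.exp_le_exp.2 (by linarith)))
    rw [Set.mem_ofPred_eq] at hω ⊢
    rw [← hu]
    exact mul_le_mul_of_nonneg_left hω htpos.le
  · refine (measureReal_mono fun ω hω => ?_).trans
      ((FLL.measureReal_ncard_ball_one_le hindep hunif (-t) (4 * c ^ 2)).trans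
        (Real.exp_le_exp.2 (by rw [neg_mul, neg_sq]; linarith)))
    rw [Set.mem_ofPred_eq] at hω ⊢
    rw [← hu, neg_mul, le_neg, ← mul_neg]
    exact mul_le_mul_of_nonneg_left hω htpos.le
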